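/- Let $\Bbbk$ be an algebraically closed field of characteristic $0$ (for instance $\mathbb{C}$). Put \[ t = \begin{pmatrix} 0 & 0 & 1 \\ 1 & 0 & 0 \\ 0 & 1 & 0 \end{pmatrix}, \qquad r = \begin{pmatrix} 0 & \alpha & 0 \\ \beta & 0 & 0 \\ 0 & 0 & \gamma \end{pmatrix} \quad\text{with } \alpha,\beta,\gamma\in\Bbbk,\ \alpha\beta\gamma = -1 . \] A finite subgroup $G \leq \operatorname{SL}_3(\Bbbk)$ is of type (C) if $G = \langle A, t\rangle$ for some non-trivial group $A \leq \operatorname{SL}_3(\Bbbk)$ of diagonal matrices, and of type (D) if $G = \langle A, t, r\rangle$ for some such $A$ and some such $r$. Let $N$ be the (abelian, normal) subgroup of all diagonal matrices in $G$; then $G = N \rtimes K$ with $K \simeq C_3$ in type (C) and $K \simeq S_3$ in type (D). The McKay quiver $Q_G$ of $G$ has as vertices the isomorphism classes of irreducible representations of $G$ over $\Bbbk$, and the arrows from $\chi$ to $\psi$ are a basis of $\operatorname{Hom}_{\Bbbk G}(\chi, \psi\otimes\rho)$, where $\rho$ is the natural representation of $G$ on $\Bbbk^3$. **Lemma.** Let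 $G = N \rtimes K$ be of type (C) or (D). If $3 \nmid |N|$, then the McKay quiver $Q_G$ has a loop, that is, an arrow from some vertex to itself. -/

import Mathlib

open Matrix

noncomputable section

/-! ### Groups of type (C) and (D) -/

/-- The subgroup of diagonal matrices in `SL_n(k)`. -/
def diagonalSL (n : ℕ) (k : Type*) [Field k] : Subgroup (SpecialLinearGroup (Fin n) k) where
  carrier := {g | (g : Matrix (Fin n) (Fin n) k).IsDiag}
  one_mem' := Matrix.isDiag_one
  mul_mem' := by
    rintro ⟨a, _⟩ ⟨b, _⟩ (ha : a.IsDiag) (hb : b.IsDiag)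
    change (a * b).IsDiag
    rw [← ha.diagonal_diag, ← hb.diagonal_diag, diagonal_mul_diagonal]
    exact isDiag_diagonal _
  inv_mem' := by
    rintro ⟨a, _⟩ (ha : a.IsDiag)
    change a.adjugate.IsDiag
    rw [← ha.diagonal_diag, adjugate_diagonal]
    exact isDiag_diagonal _

/-- The permutation matrix `t` of a 3-cycle. -/
def matT (k : Type*) [Field k] : SpecialLinearGroup (Fin 3) k :=
  ⟨!![0, 0, 1; 1, 0, 0; 0, 1, 0], by simp [Matrix.det_fin_three]⟩

/-- The monomial matrix `r` with parameters `α, β, γ` satisfying `α * β * γ = -1`. -/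
def matR {k : Type*} [Field k] (α β γ : k) (h : α * β * γ = -1) : SpecialLinearGroup (Fin 3) k :=
  ⟨!![0, α, 0; β, 0, 0; 0, 0, γ], by simp [Matrix.det_fin_three, h]⟩

/-- `G` is of type (C): it is generated by a non-trivial diagonal group `A` together with `t`. -/
def IsTypeC {k : Type*} [Field k] (G : Subgroup (SpecialLinearGroup (Fin 3) k)) : Prop :=
  ∃ A : Subgroup (SpecialLinearGroup (Fin 3) k),
    A ≤ diagonalSL 3 k ∧ A ≠ ⊥ ∧
      G = Subgroup.closure ((A : Set (SpecialLinearGroup (Fin 3) k)) ∪ {matT k})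

/-- `G` is of type (D): it is generated by a non-trivial diagonal group `A` together with `t` and
some monomial matrix `r`. -/
def IsTypeD {k : Type*} [Field k] (G : Subgroup (SpecialLinearGroup (Fin 3) k)) : Prop :=
  ∃ A : Subgroup (SpecialLinearGroup (Fin 3) k),
    A ≤ diagonalSL 3 k ∧ A ≠ ⊥ ∧
      ∃ (α β γ : k) (h : α * β * γ = -1),
        G = Subgroup.closure
          ((A : Set (SpecialLinearGroup (Fin 3) k)) ∪ {matT k, matR α β γ h})

/-- The subgroup `N` of `G` consisting of the diagonal matrices in `G`. -/
def diagonalPart {n : ℕ} {k : Type*} [Field k] (G : Subgroup (SpecialLinearGroup (Fin n) k)) :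
    Subgroup G :=
  (diagonalSL n k).subgroupOf G

/-! ### The McKay quiver -/

/-- The natural representation of `G ≤ SL_n(k)` on `k^n`. -/
def naturalRep {n : ℕ} {k : Type*} [Field k] (G : Subgroup (SpecialLinearGroup (Fin n) k)) :
    Representation k G (Fin n → k) where
  toFun g := Matrix.toLin' ((g : SpecialLinearGroup (Fin n) k) : Matrix (Fin n) (Fin n) k)
  map_one' := by simp; rfl
  map_mul' g h := by simp [Matrix.toLin'_mul]; rfl

/-- A finite-dimensional irreducible representation of `G` over `k`, realized on some `k^d`. -/
structure IrrRep (k : Type*) [Field k] (G : Type*) [Group G] where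
  /-- the dimension -/
  dim : ℕ
  /-- the action on `k^dim` -/
  rep : Representation k G (Fin dim → k)
  /-- the representation is irreducible -/
  irreducible : rep.IsIrreducible

/-- Isomorphism of irreducible representations. -/
instance irrRepSetoid (k : Type*) [Field k] (G : Type*) [Group G] : Setoid (IrrRep k G) where
  r V W := Nonempty (V.rep.Equiv W.rep)
  iseqv :=
    { refl := fun V => ⟨Representation.Equiv.refl V.rep⟩
      symm := fun ⟨e⟩ => ⟨e.symm⟩
      trans := fun ⟨e⟩ ⟨f⟩ => ⟨e.trans f⟩ }

/-- `Irr(G)`: the isomorphism classes of irreducible representations of `G` over `k`. -/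
def Irr (k : Type*) [Field k] (G : Type*) [Group G] : Type _ :=
  Quotient (irrRepSetoid k G)

/-- A chosen representative of an isomorphism class of irreducible representations. -/
def Irr.repr {k : Type*} [Field k] {G : Type*} [Group G] (χ : Irr k G) : IrrRep k G :=
  Quotient.out χ

/-- The vertex set of the McKay quiver `Q_G` of `G ≤ SL_n(k)`: the set `Irr(G)`. -/
def McKayQuiver {n : ℕ} {k : Type*} [Field k] (G : Subgroup (SpecialLinearGroup (Fin n) k)) :
    Type _ :=
  Irr k G

/-- The vertex of the McKay quiver as an isomorphism class of irreducible representations. -/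
def McKayQuiver.toIrr {n : ℕ} {k : Type*} [Field k]
    {G : Subgroup (SpecialLinearGroup (Fin n) k)} (χ : McKayQuiver G) : Irr k G :=
  χ

/-- The arrows `χ ⟶ ψ` of the McKay quiver are the elements of a (chosen) `k`-basis of
`Hom_{kG}(χ, ψ ⊗ ρ)`, where `ρ` is the natural representation of `G`. -/
instance McKayQuiver.quiver {n : ℕ} {k : Type*} [Field k]
    (G : Subgroup (SpecialLinearGroup (Fin n) k)) : Quiver (McKayQuiver G) where
  Hom χ ψ :=
    Module.Basis.ofVectorSpaceIndex k
      (Representation.IntertwiningMap χ.toIrr.repr.rep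
        (Representation.tprod ψ.toIrr.repr.rep (naturalRep G)))

/-- A quiver has a loop if it has an arrow from some vertex to itself. -/
def HasLoop (Q : Type*) [Quiver Q] : Prop :=
  ∃ v : Q, Nonempty (v ⟶ v)

end

/-!
Let `N` be the diagonal part of `G` and `ε₀, ε₁, ε₂` the characters by which `N` acts on the
coordinate lines of the natural representation `ρ`; thus `ε₀ ε₁ ε₂ = 1`. All elements of `G` are
monomial matrices, and their non-zero entries are roots of unity of order dividing `2 * |N|`
(`le_monomialSL`), an order prime to `3`. So there is an `m`, necessarily odd, with
`x ^ (3 * m) = x` for all these entries. A loop is exhibited as an irreducible representation `χ`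
together with an explicit non-zero intertwining map `χ → χ ⊗ ρ` (`hasLoop_mcKayQuiver`).

Assume first that some entry of an element of `N` is not `± 1`. Let `χ` be the representation
induced from the character `(ε₁ / ε₀) ^ m` of `N`. Its conjugates are among the characters
`(ε_j / ε_i) ^ m`, which are pairwise distinct: since `N` is stable under cyclic shifts, a
coincidence would force the entries of `N` to be sixth roots of unity
(`pow_six_eq_one_of_weights_eq`), hence `± 1`. So `χ` is irreducible
(`Representation.isIrreducible_of_monomial`). From `ε_j = ε_j ^ (3 * m)` and `ε_i ε_j ε_l = 1` one
gets `(ε_j / ε_i) ^ m = (ε_l / ε_j) ^ m * ε_j`, which says that each weight vector of `χ` has a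
partner of the same weight in `χ ⊗ ρ`; with a sign, matching these is equivariant for the whole of
`G` (`MonomialData.hasLoop_of_coeff_sq_ne_one`).

If on the contrary all entries of `N` are `± 1`, then so are the non-zero entries of all elements of
`G`, and `ρ` is irreducible and self-dual. As `det ρ = 1`, the representation `ρ ≅ Λ²ρ` embeds into
`ρ ⊗ ρ`, and `χ = ρ` carries a loop (`MonomialData.hasLoop_of_coeff_sq_eq_one`).
-/

/-! ### Irreducible representations and loops of the McKay quiver -/

namespace Representation

variable {k G V : Type*} [Field k] [Group G] [AddCommGroup V] [Module k V]

theorem isIrreducible_of_forall_eq_top [Nontrivial V] {ρ : Representation k G V}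
    (h : ∀ (W : Subrepresentation ρ), ∀ v ∈ W.toSubmodule, v ≠ 0 → W.toSubmodule = ⊤) :
    ρ.IsIrreducible := by
  have hne : (⊥ : Subrepresentation ρ) ≠ ⊤ := fun hbt =>
    bot_ne_top (α := Submodule k V) (congrArg Subrepresentation.toSubmodule hbt)
  refine { exists_pair_ne := ⟨⊥, ⊤, hne⟩, eq_bot_or_eq_top := fun W => ?_ }
  by_cases hW : W.toSubmodule = ⊥
  · exact Or.inl (Subrepresentation.toSubmodule_injective hW)
  · obtain ⟨v, hv, hv0⟩ := Submodule.exists_mem_ne_zero_of_ne_bot hW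
    exact Or.inr (Subrepresentation.toSubmodule_injective (h W v hv hv0))

theorem Equiv.isIrreducible {V' : Type*} [AddCommGroup V'] [Module k V'] [Nontrivial V']
    {ρ : Representation k G V} {σ : Representation k G V'} (e : ρ.Equiv σ)
    (hρ : ρ.IsIrreducible) : σ.IsIrreducible := by
  refine isIrreducible_of_forall_eq_top fun W v hv hv0 => ?_
  let U : Subrepresentation ρ :=
    ⟨W.toSubmodule.comap e.toLinearMap, fun g v hv => by
      have := W.apply_mem_toSubmodule g hv
      rw [Submodule.mem_comap]
      have h2 : e (ρ g v) = σ g (e v) :=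
        IntertwiningMap.isIntertwining _ _ e.toIntertwiningMap g v
      change e (ρ g v) ∈ _
      rw [h2]; exact this⟩
  have hU : e.symm v ∈ U.toSubmodule := by
    change e (e.symm v) ∈ W.toSubmodule
    simpa using hv
  rcases hρ.eq_bot_or_eq_top U with h | h
  · rw [h] at hU
    have h0 : e.symm v = 0 := hU
    exact absurd (by simpa using congrArg e h0) hv0
  · rw [eq_top_iff]
    intro x _
    have : e.symm x ∈ U.toSubmodule := by rw [h]; exact Submodule.mem_top
    change e (e.symm x) ∈ W.toSubmodule at this
    simpa using this

/-- Suppose `G` permutes the coordinate lines of `X → k` through `π`, with weights `w`. If it permutes the lines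
transitively and the weights of the subgroup fixing every line separate the lines, the representation is irreducible: a non-zero vector of minimal support in
a subrepresentation is a multiple of a basis vector. -/
theorem isIrreducible_of_monomial {X : Type*} [Fintype X] [DecidableEq X] [Nonempty X]
    {ρ : Representation k G (X → k)} {π : G →* _root_.Equiv.Perm X} {w : G → X → k}
    (hρ : ∀ g x, ρ g (Pi.single x 1) = w g x • Pi.single (π g x) 1)
    (hw : ∀ g x, w g x ≠ 0) (htrans : ∀ x y, ∃ g, π g x = y)
    (hsep : ∀ x y, x ≠ y → ∃ g, π g = 1 ∧ w g x ≠ w g y) : ρ.IsIrreducible := by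
  classical
  have hdiag : ∀ g, π g = 1 → ∀ v x, ρ g v x = w g x * v x := by
    intro g hg v x
    conv_lhs => rw [pi_eq_sum_univ' v, map_sum]
    simp [hρ, hg, Finset.sum_apply, Pi.single_apply, mul_comm]
  refine isIrreducible_of_forall_eq_top fun W v hv hv0 => ?_
  have key : ∀ (n : ℕ) (v : X → k), v ∈ W.toSubmodule → v ≠ 0 →
      (Finset.univ.filter fun x => v x ≠ 0).card = n →
      ∃ x, (Pi.single x 1 : X → k) ∈ W.toSubmodule := by
    intro n
    induction n using Nat.strong_induction_on with
    | _ n ih =>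
      intro v hv hv0 hn
      obtain ⟨x, hx⟩ := Function.ne_iff.mp hv0
      by_cases hy : ∃ y, y ≠ x ∧ v y ≠ 0
      · obtain ⟨y, hyx, hy⟩ := hy
        obtain ⟨g, hg, hgw⟩ := hsep y x hyx
        have hu : ∀ z, (ρ g v - w g x • v) z = (w g z - w g x) * v z := by
          intro z
          simp only [Pi.sub_apply, Pi.smul_apply, smul_eq_mul, hdiag g hg]
          ring
        -- `ρ g v - w g x • v` vanishes wherever `v` does, and also at `x`, but not at `y`.
        refine ih _ ?_ (ρ g v - w g x • v)
          (sub_mem (W.apply_mem_toSubmodule g hv) (W.toSubmodule.smul_mem _ hv)) ?_ rfl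
        · rw [← hn]
          refine Finset.card_lt_card (Finset.ssubset_iff_of_subset ?_ |>.mpr ⟨x, ?_, ?_⟩)
          · intro z hz
            simp only [Finset.mem_filter, Finset.mem_univ, true_and, hu] at hz ⊢
            exact right_ne_zero_of_mul hz
          · simpa using hx
          · simp [hu]
        · refine Function.ne_iff.mpr ⟨y, ?_⟩
          rw [hu]
          exact mul_ne_zero (sub_ne_zero.mpr hgw) hy
      · push Not at hy
        refine ⟨x, ?_⟩
        have : (Pi.single x 1 : X → k) = (v x)⁻¹ • v := by
          ext z
          rcases eq_or_ne z x with rfl | hz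
          · simp [inv_mul_cancel₀ hx]
          · simp [hz, hy z hz]
        rw [this]
        exact W.toSubmodule.smul_mem _ hv
  obtain ⟨x, hx⟩ := key _ v hv hv0 rfl
  rw [eq_top_iff]
  intro u _
  rw [pi_eq_sum_univ' u]
  refine sum_mem fun y _ => W.toSubmodule.smul_mem _ ?_
  obtain ⟨g, rfl⟩ := htrans x y
  have h1 := W.apply_mem_toSubmodule g hx
  rw [hρ] at h1
  have h2 := W.toSubmodule.smul_mem (w g x)⁻¹ h1
  rw [smul_smul, inv_mul_cancel₀ (hw g x), one_smul] at h2
  convert h2 using 1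

/-- The monomial representation on `X → k` attached to a permutation action `π` of `G` on `X` and a
cocycle `w : G → X → k`; it sends the basis vector at `x` to `w g x` times the one at `π g x`. -/
def monomialRep {X : Type*} (π : G →* _root_.Equiv.Perm X) (w : G → X → k)
    (w_one : ∀ x, w 1 x = 1) (w_mul : ∀ g h x, w (g * h) x = w g (π h x) * w h x) :
    Representation k G (X → k) where
  toFun g :=
    { toFun := fun f x => w g ((π g)⁻¹ x) * f ((π g)⁻¹ x)
      map_add' := fun f f' => by ext x; simp [mul_add]
      map_smul' := fun c f => by ext x; simp [mul_left_comm] }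
  map_one' := by
    ext1 f
    simp [w_one]
  map_mul' g h := by
    ext1 f
    funext x
    simp [w_mul, mul_assoc]

theorem monomialRep_single {X : Type*} [DecidableEq X] (π : G →* _root_.Equiv.Perm X)
    (w : G → X → k) (w_one : ∀ x, w 1 x = 1)
    (w_mul : ∀ g h x, w (g * h) x = w g (π h x) * w h x) (g : G) (x : X) :
    monomialRep π w w_one w_mul g (Pi.single x 1) = w g x • Pi.single (π g x) 1 := by
  funext y
  change w g ((π g)⁻¹ y) * (Pi.single x 1 : X → k) ((π g)⁻¹ y) = _
  by_cases h : y = π g x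
  · subst h; simp
  · have h' : (π g)⁻¹ y ≠ x := fun h' => h (by simp [← h'])
    rw [Pi.single_eq_of_ne h', mul_zero, Pi.smul_apply, Pi.single_eq_of_ne h, smul_zero]

end Representation

/-- A loop of the McKay quiver may be exhibited on any finite-dimensional model of an irreducible
representation `χ`, as a non-zero intertwining map `χ → χ ⊗ ρ`. -/
theorem hasLoop_mcKayQuiver {n : ℕ} {k V : Type*} [Field k]
    {G : Subgroup (SpecialLinearGroup (Fin n) k)} [AddCommGroup V] [Module k V]
    [FiniteDimensional k V] {ρ : Representation k G V} (hρ : ρ.IsIrreducible)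
    (f : Representation.IntertwiningMap ρ (ρ.tprod (naturalRep G))) {v : V} (hf : f v ≠ 0) :
    HasLoop (McKayQuiver G) := by
  let b := (Module.finBasis k V).equivFun
  let σ : Representation k G (Fin (Module.finrank k V) → k) :=
    { toFun := fun g => b.conj (ρ g)
      map_one' := by rw [map_one]; exact LinearEquiv.conj_id b
      map_mul' := fun g h => by rw [map_mul]; exact LinearEquiv.conj_comp b _ _ }
  let e₁ : ρ.Equiv σ := Representation.Equiv.mk b fun g => by
    ext1 x; simp [σ, LinearEquiv.conj_apply]
  have hv : v ≠ 0 := by rintro rfl; simp at hf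
  have : Nontrivial V := ⟨v, 0, hv⟩
  have : Nontrivial (Fin (Module.finrank k V) → k) := b.symm.toEquiv.nontrivial
  let I : IrrRep k G := ⟨_, σ, e₁.isIrreducible hρ⟩
  let χ : McKayQuiver G := (Quotient.mk (irrRepSetoid k G) I : Irr k G)
  refine ⟨χ, ?_⟩
  -- The vertex `χ` only remembers the class of `σ`; the arrows are taken at a chosen representative.
  obtain ⟨e₂⟩ : Nonempty (χ.toIrr.repr.rep.Equiv σ) := Quotient.mk_out (s := irrRepSetoid k G) I
  let e : χ.toIrr.repr.rep.Equiv ρ := e₂.trans e₁.symm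
  let F : Representation.IntertwiningMap χ.toIrr.repr.rep
      (χ.toIrr.repr.rep.tprod (naturalRep G)) :=
    (e.symm.toIntertwiningMap.tensor (.id _)).comp (f.comp e.toIntertwiningMap)
  have hF : F ≠ 0 := by
    intro h0
    have h1 : F (e.symm v) = 0 := by rw [h0]; rfl
    have h2 : F (e.symm v) =
        TensorProduct.congr e.symm.toLinearEquiv (LinearEquiv.refl k (Fin n → k)) (f v) := by
      change TensorProduct.map _ _ (f (e (e.symm v))) = _
      rw [Representation.Equiv.apply_symm_apply]
      rfl
    rw [h1] at h2
    exact hf ((LinearEquiv.map_eq_zero_iff _).mp h2.symm)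
  have : Nontrivial (Representation.IntertwiningMap χ.toIrr.repr.rep
      (χ.toIrr.repr.rep.tprod (naturalRep G))) := ⟨F, 0, hF⟩
  exact (Module.Basis.ofVectorSpace k _).index_nonempty

/-! ### Monomial matrices -/

section Monomial

open Equiv

variable {n : ℕ} {k : Type*} [Field k]

/-- The monomial matrix sending the `i`-th basis vector to `d i` times the `σ i`-th one. -/
def monomialMatrix (σ : Perm (Fin n)) (d : Fin n → k) : Matrix (Fin n) (Fin n) k :=
  Matrix.of fun a i => if a = σ i then d i else 0

theorem monomialMatrix_apply (σ : Perm (Fin n)) (d : Fin n → k) (a i : Fin n) :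
    monomialMatrix σ d a i = if a = σ i then d i else 0 := rfl

theorem monomialMatrix_one : monomialMatrix (1 : Perm (Fin n)) (1 : Fin n → k) = 1 := by
  ext a i
  by_cases h : a = i <;> simp [monomialMatrix_apply, Matrix.one_apply, h]

theorem monomialMatrix_mul (σ τ : Perm (Fin n)) (d e : Fin n → k) :
    monomialMatrix σ d * monomialMatrix τ e =
      monomialMatrix (σ * τ) fun i => d (τ i) * e i := by
  ext a i
  by_cases h : a = σ (τ i) <;> simp [monomialMatrix_apply, Matrix.mul_apply, h]

theorem det_monomialMatrix (σ : Perm (Fin n)) (d : Fin n → k) :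
    (monomialMatrix σ d).det = (Perm.sign σ : ℤ) * ∏ i, d i := by
  have h : monomialMatrix σ d = (σ⁻¹).permMatrix k * Matrix.diagonal d := by
    ext a i
    by_cases h : a = σ i
    · simp [monomialMatrix_apply, Matrix.mul_diagonal, PEquiv.toMatrix_apply, h]
    · have h' : σ.symm a ≠ i := fun h' => h (by rw [← h', Equiv.apply_symm_apply])
      simp [monomialMatrix_apply, Matrix.mul_diagonal, PEquiv.toMatrix_apply, h, h']
  rw [h, Matrix.det_mul, Matrix.det_permutation, Matrix.det_diagonal, Perm.sign_inv]

theorem monomialMatrix_injective {σ τ : Perm (Fin n)} {d e : Fin n → k} (hd : ∀ i, d i ≠ 0)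
    (h : monomialMatrix σ d = monomialMatrix τ e) : σ = τ ∧ d = e := by
  have key : ∀ i, σ i = τ i ∧ d i = e i := by
    intro i
    have h1 := congrFun (congrFun h (σ i)) i
    simp only [monomialMatrix_apply, if_true] at h1
    by_cases hi : σ i = τ i
    · exact ⟨hi, by simpa [hi] using h1⟩
    · exact absurd (by simpa [hi] using h1) (hd i)
  exact ⟨Equiv.ext fun i => (key i).1, funext fun i => (key i).2⟩

theorem sign_mul_prod_eq_one {g : SpecialLinearGroup (Fin n) k} {σ : Perm (Fin n)} {d : Fin n → k}
    (h : (g : Matrix (Fin n) (Fin n) k) = monomialMatrix σ d) :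
    ((Perm.sign σ : ℤ) : k) * ∏ i, d i = 1 := by
  rw [← det_monomialMatrix, ← h, g.det_coe]

theorem ne_zero_of_coe_eq_monomialMatrix {g : SpecialLinearGroup (Fin n) k} {σ : Perm (Fin n)}
    {d : Fin n → k} (h : (g : Matrix (Fin n) (Fin n) k) = monomialMatrix σ d) (i : Fin n) :
    d i ≠ 0 :=
  Finset.prod_ne_zero_iff.mp
    (right_ne_zero_of_mul (sign_mul_prod_eq_one h ▸ one_ne_zero)) i (Finset.mem_univ i)

variable (n k) in
/-- The group of monomial matrices in `SL_n(k)` all of whose non-zero entries are `p`-th roots of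
unity. -/
def monomialSL (p : ℕ) : Subgroup (SpecialLinearGroup (Fin n) k) where
  carrier := {g | ∃ σ d, (∀ i, d i ^ p = 1) ∧
    (g : Matrix (Fin n) (Fin n) k) = monomialMatrix σ d}
  one_mem' := ⟨1, 1, by simp, by simp [monomialMatrix_one]⟩
  mul_mem' := by
    rintro g h ⟨σ, d, hd, hg⟩ ⟨τ, e, he, hh⟩
    exact ⟨σ * τ, fun i => d (τ i) * e i, fun i => by rw [mul_pow, hd, he, one_mul], by
      rw [Matrix.SpecialLinearGroup.coe_mul, hg, hh, monomialMatrix_mul]⟩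
  inv_mem' := by
    rintro g ⟨σ, d, hd, hg⟩
    refine ⟨σ⁻¹, fun i => (d (σ⁻¹ i))⁻¹, fun i => by rw [inv_pow, hd, inv_one], ?_⟩
    have h1 : monomialMatrix σ⁻¹ (fun i => (d (σ⁻¹ i))⁻¹) * (g : Matrix (Fin n) (Fin n) k) = 1 := by
      rw [hg, monomialMatrix_mul, ← monomialMatrix_one]
      congr 1
      · simp
      · funext i
        simp [inv_mul_cancel₀ (ne_zero_of_coe_eq_monomialMatrix hg i)]
    have h2 : (g : Matrix (Fin n) (Fin n) k) *
        ((g⁻¹ : SpecialLinearGroup (Fin n) k) : Matrix (Fin n) (Fin n) k) = 1 := by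
      rw [← Matrix.SpecialLinearGroup.coe_mul, mul_inv_cancel, Matrix.SpecialLinearGroup.coe_one]
    exact (left_inv_eq_right_inv h1 h2).symm

/-- A presentation of the elements of a group `G` of monomial matrices by a permutation and the
non-zero entries of the columns. -/
structure MonomialData (G : Subgroup (SpecialLinearGroup (Fin n) k)) where
  /-- the action of `G` on the coordinate lines -/
  perm : G →* Perm (Fin n)
  /-- the non-zero entry of each column -/
  coeff : G → Fin n → k
  coe_eq : ∀ g : G, ((g : SpecialLinearGroup (Fin n) k) : Matrix (Fin n) (Fin n) k) =
    monomialMatrix (perm g) (coeff g)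

namespace MonomialData

variable {G : Subgroup (SpecialLinearGroup (Fin n) k)}

theorem exists_of_le {p : ℕ} (hG : G ≤ monomialSL n k p) :
    ∃ D : MonomialData G, ∀ g i, D.coeff g i ^ p = 1 := by
  choose σ d hd h using fun g : G => hG g.2
  have hmul : ∀ g g', σ (g * g') = σ g * σ g' := fun g g' => by
    refine (monomialMatrix_injective (e := fun i => d g (σ g' i) * d g' i)
      (ne_zero_of_coe_eq_monomialMatrix (h (g * g'))) ?_).1
    rw [← h (g * g'), Subgroup.coe_mul, Matrix.SpecialLinearGroup.coe_mul, h g, h g',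
      monomialMatrix_mul]
  exact ⟨⟨MonoidHom.mk' σ hmul, d, h⟩, hd⟩

variable (D : MonomialData G)

theorem coeff_ne_zero (g : G) (i : Fin n) : D.coeff g i ≠ 0 :=
  ne_zero_of_coe_eq_monomialMatrix (D.coe_eq g) i

theorem eq_of_coe_eq {g : G} {σ : Perm (Fin n)} {d : Fin n → k}
    (h : ((g : SpecialLinearGroup (Fin n) k) : Matrix (Fin n) (Fin n) k) = monomialMatrix σ d) :
    D.perm g = σ ∧ D.coeff g = d :=
  monomialMatrix_injective (D.coeff_ne_zero g) ((D.coe_eq g).symm.trans h)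

theorem coeff_one (i : Fin n) : D.coeff 1 i = 1 :=
  congrFun (D.eq_of_coe_eq (g := 1) monomialMatrix_one.symm).2 i

theorem coeff_mul (g h : G) (i : Fin n) :
    D.coeff (g * h) i = D.coeff g (D.perm h i) * D.coeff h i := by
  refine congrFun (D.eq_of_coe_eq (g := g * h) (σ := D.perm g * D.perm h)
    (d := fun i => D.coeff g (D.perm h i) * D.coeff h i) ?_).2 i
  rw [Subgroup.coe_mul, Matrix.SpecialLinearGroup.coe_mul, D.coe_eq, D.coe_eq, monomialMatrix_mul]

theorem prod_coeff (g : G) : ∏ i, D.coeff g i = ((Perm.sign (D.perm g) : ℤ) : k) := by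
  have h := sign_mul_prod_eq_one (D.coe_eq g)
  rcases Int.units_eq_one_or (Perm.sign (D.perm g)) with hs | hs <;> rw [hs] at h ⊢
  · simpa using h
  · simpa [neg_eq_iff_eq_neg] using h

theorem naturalRep_single (g : G) (i : Fin n) :
    naturalRep G g (Pi.single i 1) = D.coeff g i • Pi.single (D.perm g i) 1 := by
  change Matrix.toLin' _ _ = _
  rw [D.coe_eq, Matrix.toLin'_apply]
  ext a
  simp [monomialMatrix_apply, Pi.single_apply]

theorem isDiag_iff (g : G) :
    ((g : SpecialLinearGroup (Fin n) k) : Matrix (Fin n) (Fin n) k).IsDiag ↔ D.perm g = 1 := by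
  rw [D.coe_eq]
  constructor
  · intro h
    by_contra hne
    obtain ⟨i, hi⟩ : ∃ i, D.perm g i ≠ i := by
      by_contra! hall
      exact hne (Equiv.ext hall)
    have := h hi
    simp only [monomialMatrix_apply, if_true] at this
    exact D.coeff_ne_zero g i this
  · intro h a i hai
    simp [monomialMatrix_apply, h, hai]

theorem eq_one_of_coeff {g : G} (h1 : D.perm g = 1) (h2 : ∀ i, D.coeff g i = 1) : g = 1 := by
  refine Subtype.ext (Subtype.ext ?_)
  change ((g : SpecialLinearGroup (Fin n) k) : Matrix (Fin n) (Fin n) k) = 1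
  rw [D.coe_eq, h1, show D.coeff g = 1 from funext h2, monomialMatrix_one]

end MonomialData

/-! ### Groups of type (C) and (D) are monomial -/

theorem coe_matT : (matT k : Matrix (Fin 3) (Fin 3) k) = monomialMatrix (finRotate 3) 1 := by
  ext a i
  fin_cases a <;> fin_cases i <;> simp [matT, monomialMatrix_apply]

theorem coe_matR {α β γ : k} (h : α * β * γ = -1) :
    (matR α β γ h : Matrix (Fin 3) (Fin 3) k) = monomialMatrix (swap 0 1) ![β, α, γ] := by
  ext a i
  fin_cases a <;> fin_cases i <;> simp [matR, monomialMatrix_apply, swap_apply_def]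

theorem matT_mem {G : Subgroup (SpecialLinearGroup (Fin 3) k)} (hG : IsTypeC G ∨ IsTypeD G) :
    matT k ∈ G := by
  rcases hG with ⟨A, -, -, rfl⟩ | ⟨A, -, -, α, β, γ, h, rfl⟩ <;>
    exact Subgroup.subset_closure (by simp)

/-- If the eigenvalues of the diagonal part of `G` are `p`-th roots of unity, with `p` even, so are
all the non-zero entries of the elements of `G`: those of `r` are, up to sign, inverses of entries
of the diagonal matrices `r ^ 2`, `(r * t) ^ 2` and `(r * t ^ 2) ^ 2`. -/
theorem le_monomialSL {G : Subgroup (SpecialLinearGroup (Fin 3) k)} (hG : IsTypeC G ∨ IsTypeD G)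
    {p : ℕ} (hp : Even p)
    (hN : ∀ g ∈ G, (g : Matrix (Fin 3) (Fin 3) k).IsDiag → ∀ i, g i i ^ p = 1) :
    G ≤ monomialSL 3 k p := by
  have hT : matT k ∈ monomialSL 3 k p := ⟨_, _, by simp, coe_matT⟩
  have hA : ∀ g ∈ G, (g : Matrix (Fin 3) (Fin 3) k).IsDiag → g ∈ monomialSL 3 k p := by
    intro g hg hd
    refine ⟨1, fun i => g i i, hN g hg hd, ?_⟩
    ext a i
    by_cases h : a = i
    · simp [monomialMatrix_apply, h]
    · simp [monomialMatrix_apply, h, hd h]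
  have htG := matT_mem hG
  rcases hG with ⟨A, hAd, -, hGA⟩ | ⟨A, hAd, -, α, β, γ, h, hGA⟩
  · have hAG : ∀ g ∈ A, g ∈ G := fun g hg => hGA ▸ Subgroup.subset_closure (Or.inl hg)
    rw [hGA, Subgroup.closure_le]
    rintro g (hg | rfl)
    · exact hA g (hAG g hg) (hAd hg)
    · exact hT
  · have hAG : ∀ g ∈ A, g ∈ G := fun g hg => hGA ▸ Subgroup.subset_closure (Or.inl hg)
    have hrG : matR α β γ h ∈ G := hGA ▸ Subgroup.subset_closure (by simp)
    have hr : ∀ g ∈ G, ∀ x y z : k, (g : Matrix (Fin 3) (Fin 3) k) = !![x, 0, 0; 0, y, 0; 0, 0, z] →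
        x ^ p = 1 ∧ y ^ p = 1 := by
      intro g hg x y z hxyz
      have hd : (g : Matrix (Fin 3) (Fin 3) k).IsDiag := by
        rw [hxyz]
        intro a i hai
        fin_cases a <;> fin_cases i <;> simp at hai ⊢
      have h0 := hN g hg hd 0
      have h1 := hN g hg hd 1
      rw [hxyz] at h0 h1
      exact ⟨by simpa using h0, by simpa using h1⟩
    have hcR : (matR α β γ h : Matrix (Fin 3) (Fin 3) k) = !![0, α, 0; β, 0, 0; 0, 0, γ] := rfl
    have hcT : (matT k : Matrix (Fin 3) (Fin 3) k) = !![0, 0, 1; 1, 0, 0; 0, 1, 0] := rfl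
    have e1 : (α * β) ^ p = 1 := (hr _ (mul_mem hrG hrG) (α * β) (α * β) (γ * γ) (by
      simp only [Matrix.SpecialLinearGroup.coe_mul, hcR]
      ext a i
      fin_cases a <;> fin_cases i <;> simp [Matrix.mul_apply, Fin.sum_univ_three, mul_comm])).1
    have e2 : (γ * β) ^ p = 1 := (hr _
      (mul_mem (mul_mem hrG htG) (mul_mem hrG htG)) (α * α) (γ * β) (γ * β) (by
      simp only [Matrix.SpecialLinearGroup.coe_mul, hcR, hcT]
      ext a i
      fin_cases a <;> fin_cases i <;> simp [Matrix.mul_apply, Fin.sum_univ_three, mul_comm])).2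
    have e3 : (α * γ) ^ p = 1 := (hr _
      (mul_mem (mul_mem hrG (mul_mem htG htG)) (mul_mem hrG (mul_mem htG htG)))
        (α * γ) (β * β) (α * γ) (by
      simp only [Matrix.SpecialLinearGroup.coe_mul, hcR, hcT]
      ext a i
      fin_cases a <;> fin_cases i <;> simp [Matrix.mul_apply, Fin.sum_univ_three, mul_comm])).1
    have hpow : ∀ x y : k, x * y = -1 → y ^ p = 1 → x ^ p = 1 := by
      intro x y hxy hy
      have := congrArg (· ^ p) hxy
      simpa [mul_pow, hy, hp.neg_one_pow] using this
    have hR : matR α β γ h ∈ monomialSL 3 k p := by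
      refine ⟨_, _, fun i => ?_, coe_matR h⟩
      fin_cases i
      · exact hpow β (α * γ) (by rw [← h]; ring) e3
      · exact hpow α (γ * β) (by rw [← h]; ring) e2
      · exact hpow γ (α * β) (by rw [← h]; ring) e1
    rw [hGA, Subgroup.closure_le]
    rintro g (hg | rfl | rfl)
    · exact hA g (hAG g hg) (hAd hg)
    · exact hT
    · exact hR

end Monomial

/-! ### The weights of the diagonal part -/

section Weights

open Equiv

variable {k : Type*} [Field k]

/-- Two weights `a j / a i` and `a q / a p` attached to different ordered pairs can agree on a
diagonal matrix of determinant one and on its cyclic shifts only if its entries are sixth roots of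
unity. -/
theorem pow_six_eq_one_of_weights_eq {a : Fin 3 → k} (hdet : ∏ i, a i = 1) {i j p q : Fin 3}
    (hij : i ≠ j) (hpq : p ≠ q) (hne : ¬ (i = p ∧ j = q))
    (h : ∀ s, a (j + s) * a (p + s) = a (q + s) * a (i + s)) : a 0 ^ 6 = 1 := by
  have h0 := h 0
  have h1 := h 1
  have h2 := h 2
  rw [Fin.prod_univ_three] at hdet
  clear h
  generalize hx : a 0 = x at *
  generalize hy : a 1 = y at *
  generalize hz : a 2 = z at *
  fin_cases i <;> fin_cases j <;> fin_cases p <;> fin_cases q <;>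
    first
    | exact absurd rfl hij
    | exact absurd rfl hpq
    | exact absurd ⟨rfl, rfl⟩ hne
    | (simp [hx, hy, hz] at h0 h1 h2
       grind)

namespace MonomialData

variable {G : Subgroup (SpecialLinearGroup (Fin 3) k)} (D : MonomialData G)

theorem perm_matT (ht : matT k ∈ G) : D.perm ⟨matT k, ht⟩ = finRotate 3 :=
  (D.eq_of_coe_eq coe_matT).1

theorem coeff_matT (ht : matT k ∈ G) (i : Fin 3) : D.coeff ⟨matT k, ht⟩ i = 1 :=
  congrFun (D.eq_of_coe_eq (g := ⟨matT k, ht⟩) coe_matT).2 i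

theorem exists_perm_eq (ht : matT k ∈ G) (i j : Fin 3) : ∃ g, D.perm g i = j := by
  refine ⟨⟨matT k, ht⟩ ^ (j - i : Fin 3).val, ?_⟩
  rw [map_pow, D.perm_matT ht]
  revert i j
  decide

/-- Conjugation by powers of `t` shifts the entries of a diagonal matrix cyclically. -/
theorem exists_coeff_add (ht : matT k ∈ G) {g : G} (hg : D.perm g = 1) (s : Fin 3) :
    ∃ g', D.perm g' = 1 ∧ ∀ i, D.coeff g' i = D.coeff g (i + s) := by
  have step : ∀ g : G, D.perm g = 1 → ∃ g', D.perm g' = 1 ∧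
      ∀ i, D.coeff g' i = D.coeff g (i + 1) := by
    intro g hg
    have h1 : D.perm ((⟨matT k, ht⟩ : G)⁻¹ * g * ⟨matT k, ht⟩) = 1 := by simp [hg]
    refine ⟨_, h1, fun i => ?_⟩
    have h2 := D.coeff_mul ⟨matT k, ht⟩ ((⟨matT k, ht⟩ : G)⁻¹ * g * ⟨matT k, ht⟩) i
    rw [← mul_assoc, mul_inv_cancel_left, D.coeff_mul, D.coeff_matT, D.coeff_matT, D.perm_matT,
      mul_one, one_mul, finRotate_apply] at h2
    exact h2.symm
  obtain ⟨g1, h1, e1⟩ := step g hg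
  obtain ⟨g2, h2, e2⟩ := step g1 h1
  fin_cases s
  · exact ⟨g, hg, fun i => by simp⟩
  · exact ⟨g1, h1, e1⟩
  · refine ⟨g2, h2, fun i => ?_⟩
    rw [e2, e1, add_assoc]
    rfl

theorem prod_coeff_comp_perm (g : G) (τ : Perm (Fin 3)) :
    D.coeff g (τ 0) * D.coeff g (τ 1) * D.coeff g (τ 2) =
      ((Perm.sign (D.perm g) : ℤ) : k) := by
  rw [← D.prod_coeff, ← Equiv.prod_comp τ, Fin.prod_univ_three]

/-! ### Groups of signed permutation matrices -/

/-- For a group of signed permutation matrices the natural representation `ρ` is self-dual, so that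
`ρ ≅ Λ²ρ` embeds into `ρ ⊗ ρ`: there is a loop at `ρ`. -/
theorem hasLoop_of_coeff_sq_eq_one (ht : matT k ∈ G) (hsq : ∀ g i, D.coeff g i ^ 2 = 1)
    {g₀ : G} (hg₀ : D.perm g₀ = 1) (hne : g₀ ≠ 1) : HasLoop (McKayQuiver G) := by
  have hirr : (naturalRep G).IsIrreducible := by
    refine Representation.isIrreducible_of_monomial D.naturalRep_single D.coeff_ne_zero
      (D.exists_perm_eq ht) fun i j hij => ?_
    by_contra! hall
    have hs : ∀ s, D.coeff g₀ (i + s) = D.coeff g₀ (j + s) := by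
      intro s
      obtain ⟨g, hg, he⟩ := D.exists_coeff_add ht hg₀ s
      rw [← he, ← he]
      exact hall g hg
    -- All entries of `g₀` agree; their cube is the determinant and their square is one.
    have hconst : ∀ l, D.coeff g₀ l = D.coeff g₀ 0 := by
      have h0 := hs 0
      have h1 := hs 1
      have h2 := hs 2
      intro l
      fin_cases i <;> fin_cases j <;> fin_cases l <;>
        first
        | rfl
        | exact absurd rfl hij
        | (simp at h0 h1 h2 ⊢
           grind)
    refine hne (D.eq_one_of_coeff hg₀ fun l => ?_)
    have h3 := D.prod_coeff g₀
    rw [hg₀, Fin.prod_univ_three, hconst 1, hconst 2] at h3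
    have h2 := hsq g₀ 0
    rw [hconst l]
    simp only [Perm.sign_one, Units.val_one, Int.cast_one] at h3
    linear_combination h3 - D.coeff g₀ 0 * h2
  let F : Fin 3 → TensorProduct k (Fin 3 → k) (Fin 3 → k) := fun i =>
    ∑ τ : Perm (Fin 3), if τ 0 = i then ((Perm.sign τ : ℤ) : k) •
      (TensorProduct.tmul k (Pi.single (τ 1) 1 : Fin 3 → k) (Pi.single (τ 2) 1 : Fin 3 → k)) else 0
  let f : (Fin 3 → k) →ₗ[k] TensorProduct k (Fin 3 → k) (Fin 3 → k) :=
    (Pi.basisFun k (Fin 3)).constr k F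
  have hf : ∀ i, f (Pi.single i 1) = F i := fun i => by
    rw [← Pi.basisFun_apply, Module.Basis.constr_basis]
  have hcomm : ∀ g, f ∘ₗ naturalRep G g = ((naturalRep G).tprod (naturalRep G)) g ∘ₗ f := by
    intro g
    refine (Pi.basisFun k (Fin 3)).ext fun i => ?_
    rw [Pi.basisFun_apply, LinearMap.comp_apply, LinearMap.comp_apply, hf, D.naturalRep_single,
      map_smul, hf, Representation.tprod_apply, map_sum, Finset.smul_sum,
      ← Equiv.sum_comp (Equiv.mulLeft (D.perm g))]
    refine Finset.sum_congr rfl fun τ _ => ?_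
    simp only [Equiv.coe_mulLeft, Perm.mul_apply, EmbeddingLike.apply_eq_iff_eq]
    split_ifs with h
    · rw [map_smul, TensorProduct.map_tmul, D.naturalRep_single, D.naturalRep_single,
        TensorProduct.smul_tmul_smul, smul_smul, smul_smul, ← h]
      congr 1
      rw [Perm.sign_mul, Units.val_mul, Int.cast_mul, ← D.prod_coeff_comp_perm g τ]
      linear_combination (((Perm.sign τ : ℤ) : k) * D.coeff g (τ 1) * D.coeff g (τ 2)) *
        hsq g (τ 0)
    · simp
  refine hasLoop_mcKayQuiver hirr ⟨f, hcomm⟩ (v := Pi.single 0 1) fun h0 => ?_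
  have h1 : F 0 = 0 := (hf 0).symm.trans h0
  -- The functional reading off the coefficient of `e₁ ⊗ e₂` sees only the summand `τ = 1`.
  have h2 := congrArg (TensorProduct.lift (LinearMap.mk₂ k
    (fun u v : Fin 3 → k => u 1 * v 2) (by intros; simp [add_mul]) (by intros; simp [mul_assoc])
    (by intros; simp [mul_add]) (by intros; simp [mul_left_comm]))) h1
  rw [map_sum, LinearMap.map_zero, Finset.sum_eq_single (1 : Perm (Fin 3))] at h2
  · simp at h2
  · intro τ _ hτ
    split_ifs with h
    · have h12 : ¬ (τ 1 = 1 ∧ τ 2 = 2) := by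
        rintro ⟨h', h''⟩
        refine hτ (Equiv.ext fun i => ?_)
        fin_cases i
        · exact h
        · exact h'
        · exact h''
      rw [map_smul, TensorProduct.lift.tmul, LinearMap.mk₂_apply]
      by_cases h3 : τ 1 = 1
      · rw [Pi.single_eq_of_ne (i := τ 2) (i' := 2) fun h4 => h12 ⟨h3, h4.symm⟩, mul_zero,
          smul_zero]
      · rw [Pi.single_eq_of_ne (i := τ 1) (i' := 1) (Ne.symm h3), zero_mul, smul_zero]
    · simp
  · simp

/-! ### The twisted regular orbit -/

/-- The loop in the generic case sits at the representation `χ` induced from the character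
`(ε₁ / ε₀) ^ m` of the diagonal part, where `ε₀, ε₁, ε₂` are the weights of `ρ` and `m` is inverse
to `3`. It is realized on the functions on the image `H` of `G` in the symmetric group, with basis
vectors `e τ` of weight `(ε_{τ 1} / ε_{τ 0}) ^ m`. As `ε_{τ 0} * ε_{τ 1} * ε_{τ 2} = ± 1`, the vector
`e (τ * c) ⊗ e_{τ 1}`, with `c` the three-cycle, has up to sign the weight of `e τ`. -/
theorem hasLoop_of_coeff_sq_ne_one (ht : matT k ∈ G) {m : ℕ} (hm : Odd m)
    (hcube : ∀ g i, D.coeff g i ^ (3 * m) = D.coeff g i)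
    {g₀ : G} (hg₀ : D.perm g₀ = 1) {i₀ : Fin 3} (hne : D.coeff g₀ i₀ ^ 2 ≠ 1) :
    HasLoop (McKayQuiver G) := by
  classical
  let H := D.perm.range
  let π : G →* Perm H := (MulAction.toPermHom H H).comp D.perm.rangeRestrict
  have hπ : ∀ g (τ : H), (π g τ : Perm (Fin 3)) = D.perm g * τ := fun _ _ => rfl
  let w : G → H → k := fun g τ =>
    (D.coeff g ((τ : Perm (Fin 3)) 0) ^ m)⁻¹ * D.coeff g ((τ : Perm (Fin 3)) 1) ^ m
  have hw : ∀ g τ, w g τ ≠ 0 := fun g τ =>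
    mul_ne_zero (inv_ne_zero (pow_ne_zero _ (D.coeff_ne_zero _ _)))
      (pow_ne_zero _ (D.coeff_ne_zero _ _))
  have w_one : ∀ τ, w 1 τ = 1 := fun τ => by simp [w, D.coeff_one]
  have w_mul : ∀ g h τ, w (g * h) τ = w g (π h τ) * w h τ := fun g h τ => by
    simp only [w, D.coeff_mul, hπ, Perm.mul_apply, mul_pow, mul_inv]
    ring
  let ρ := Representation.monomialRep π w w_one w_mul
  have hρ : ∀ g τ, ρ g (Pi.single τ 1) = w g τ • Pi.single (π g τ) 1 :=
    Representation.monomialRep_single π w w_one w_mul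
  have hπ1 : ∀ g, D.perm g = 1 → π g = 1 := fun g hg =>
    Equiv.ext fun τ => Subtype.ext (by rw [hπ, hg, one_mul]; rfl)
  have hirr : ρ.IsIrreducible := by
    refine Representation.isIrreducible_of_monomial hρ hw ?_ ?_
    · rintro ⟨_, g, rfl⟩ ⟨_, g', rfl⟩
      exact ⟨g' * g⁻¹, Subtype.ext (by rw [hπ]; simp)⟩
    · intro τ τ' hττ'
      by_contra! hall
      have hall' : ∀ g, D.perm g = 1 →
          D.coeff g ((τ : Perm (Fin 3)) 1) * D.coeff g ((τ' : Perm (Fin 3)) 0) =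
            D.coeff g ((τ' : Perm (Fin 3)) 1) * D.coeff g ((τ : Perm (Fin 3)) 0) := by
        intro g hg
        have h := hall g (hπ1 g hg)
        simp only [w] at h
        have h0 := pow_ne_zero m (D.coeff_ne_zero g ((τ : Perm (Fin 3)) 0))
        have h0' := pow_ne_zero m (D.coeff_ne_zero g ((τ' : Perm (Fin 3)) 0))
        rw [inv_mul_eq_div, inv_mul_eq_div, div_eq_div_iff h0 h0', ← mul_pow, ← mul_pow] at h
        have h3 := congrArg (· ^ 3) h
        simp only [← pow_mul] at h3
        rwa [mul_comm m 3, mul_pow, mul_pow, hcube, hcube, hcube, hcube] at h3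
      obtain ⟨g₁, hg₁, he₁⟩ := D.exists_coeff_add ht hg₀ i₀
      have h6 : D.coeff g₁ 0 ^ 6 = 1 := by
        refine pow_six_eq_one_of_weights_eq (i := (τ : Perm (Fin 3)) 0)
          (j := (τ : Perm (Fin 3)) 1) (p := (τ' : Perm (Fin 3)) 0) (q := (τ' : Perm (Fin 3)) 1)
          ?_ (by simp) (by simp) ?_ ?_
        · rw [D.prod_coeff, hg₁]; simp
        · rintro ⟨h0, h1⟩
          refine hττ' (Subtype.ext (Equiv.ext fun i => ?_))
          have key : ∀ σ σ' : Perm (Fin 3), σ 0 = σ' 0 → σ 1 = σ' 1 → σ 2 = σ' 2 := by decide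
          fin_cases i
          · exact h0
          · exact h1
          · exact key _ _ h0 h1
        · intro s
          obtain ⟨g, hg, he⟩ := D.exists_coeff_add ht hg₁ s
          simp only [← he]
          exact hall' g hg
      rw [he₁, zero_add] at h6
      refine hne ?_
      rw [← hcube, ← pow_mul, show 3 * m * 2 = 6 * m by ring, pow_mul, h6, one_pow]
  let c : H := ⟨finRotate 3, ⟨matT k, ht⟩, D.perm_matT ht⟩
  let F : H → TensorProduct k (H → k) (Fin 3 → k) := fun τ =>
    ((Perm.sign (τ : Perm (Fin 3)) : ℤ) : k) •
      (TensorProduct.tmul k (Pi.single (τ * c) 1 : H → k)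
        (Pi.single ((τ : Perm (Fin 3)) 1) 1 : Fin 3 → k))
  let f : (H → k) →ₗ[k] TensorProduct k (H → k) (Fin 3 → k) := (Pi.basisFun k H).constr k F
  have hf : ∀ τ, f (Pi.single τ 1) = F τ := fun τ => by
    rw [← Pi.basisFun_apply, Module.Basis.constr_basis]
  have hcomm : ∀ g, f ∘ₗ ρ g = (ρ.tprod (naturalRep G)) g ∘ₗ f := by
    intro g
    refine (Pi.basisFun k H).ext fun τ => ?_
    have hπc : π g (τ * c) = π g τ * c := Subtype.ext (by simp [hπ, mul_assoc])
    rw [Pi.basisFun_apply, LinearMap.comp_apply, LinearMap.comp_apply, hf, hρ, map_smul, hf,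
      Representation.tprod_apply, map_smul, TensorProduct.map_tmul, hρ, D.naturalRep_single,
      TensorProduct.smul_tmul_smul, hπc, smul_smul, smul_smul]
    simp only [hπ, Perm.mul_apply]
    congr 1
    have c0 : ((τ * c : H) : Perm (Fin 3)) 0 = (τ : Perm (Fin 3)) 1 := rfl
    have c1 : ((τ * c : H) : Perm (Fin 3)) 1 = (τ : Perm (Fin 3)) 2 := rfl
    have hs := D.prod_coeff_comp_perm g τ
    -- Oddness of `m` lets the sign of the determinant pass through the `m`-th power.
    have hsm : ((Perm.sign (D.perm g) : ℤ) : k) ^ m = ((Perm.sign (D.perm g) : ℤ) : k) := by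
      rcases Int.units_eq_one_or (Perm.sign (D.perm g)) with h | h <;> simp [h, hm.neg_one_pow]
    have hy := hcube g ((τ : Perm (Fin 3)) 1)
    have hx0 := D.coeff_ne_zero g ((τ : Perm (Fin 3)) 0)
    have hy0 := D.coeff_ne_zero g ((τ : Perm (Fin 3)) 1)
    rw [Perm.sign_mul, Units.val_mul, Int.cast_mul, ← hsm, ← hs]
    simp only [w, c0, c1]
    generalize D.coeff g ((τ : Perm (Fin 3)) 0) = x at *
    generalize D.coeff g ((τ : Perm (Fin 3)) 1) = y at *
    generalize D.coeff g ((τ : Perm (Fin 3)) 2) = z at *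
    have hx1 := pow_ne_zero m hx0
    have hy1 := pow_ne_zero m hy0
    rw [mul_comm 3 m, pow_mul] at hy
    rw [mul_pow, mul_pow]
    generalize x ^ m = x' at *
    generalize y ^ m = y' at *
    subst hy
    field_simp
  refine hasLoop_mcKayQuiver hirr ⟨f, hcomm⟩ (v := Pi.single 1 1) fun h0 => ?_
  have h1 : F 1 = 0 := (hf 1).symm.trans h0
  have h2 := congrArg (TensorProduct.lift (LinearMap.mk₂ k
    (fun (u : H → k) (v : Fin 3 → k) => u c * v 1)
    (by intros; simp [add_mul]) (by intros; simp [mul_assoc])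
    (by intros; simp [mul_add]) (by intros; simp [mul_left_comm]))) h1
  simp [F] at h2

end MonomialData

end Weights

/-! ### Loops for groups of type (C) and (D) -/

theorem mainTheorem2 {k : Type*} [Field k] [IsAlgClosed k] [CharZero k]
    (G : Subgroup (Matrix.SpecialLinearGroup (Fin 3) k)) [Finite G]
    (hG : IsTypeC G ∨ IsTypeD G) (hN : ¬ 3 ∣ Nat.card (diagonalPart G)) :
    HasLoop (McKayQuiver G) := by
  have ht := matT_mem hG
  let N := Nat.card (diagonalPart G)
  have hNpos : 0 < N := Nat.card_pos
  have hdiag : ∀ g ∈ G, (g : Matrix (Fin 3) (Fin 3) k).IsDiag → ∀ i, g i i ^ (2 * N) = 1 := by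
    intro g hg hd i
    have h1 : (⟨⟨g, hg⟩, hd⟩ : diagonalPart G) ^ N = 1 := pow_card_eq_one'
    have h2 : g ^ N = 1 := congrArg (fun x : diagonalPart G => x.1.1) h1
    have h3 : (g : Matrix (Fin 3) (Fin 3) k) ^ N = 1 := by
      rw [← Matrix.SpecialLinearGroup.coe_pow, h2, Matrix.SpecialLinearGroup.coe_one]
    rw [← hd.diagonal_diag, Matrix.diagonal_pow] at h3
    have h4 := congrFun (congrFun h3 i) i
    rw [Matrix.diagonal_apply_eq, Matrix.one_apply_eq] at h4
    have h5 : g i i ^ N = 1 := h4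
    rw [mul_comm, pow_mul, h5, one_pow]
  obtain ⟨D, hD⟩ := MonomialData.exists_of_le (le_monomialSL hG (even_two_mul N) hdiag)
  by_cases hex : ∃ g, D.perm g = 1 ∧ ∃ i, D.coeff g i ^ 2 ≠ 1
  · obtain ⟨g₀, hg₀, i₀, hne⟩ := hex
    have hcop : Nat.Coprime 3 (2 * N) :=
      Nat.Coprime.mul_right (by norm_num) ((Nat.Prime.coprime_iff_not_dvd Nat.prime_three).mpr hN)
    -- `m` is an inverse of `3` modulo the even number `2 * N`, hence odd.
    obtain ⟨m, -, hm⟩ := Nat.exists_mul_mod_eq_one_of_coprime hcop (by omega)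
    have hdm := Nat.div_add_mod (3 * m) (2 * N)
    rw [hm] at hdm
    have hodd : Odd (3 * m) := ⟨N * (3 * m / (2 * N)), by rw [← mul_assoc, hdm]⟩
    refine D.hasLoop_of_coeff_sq_ne_one ht (Nat.odd_mul.mp hodd).2 (fun g i => ?_) hg₀ hne
    rw [← hdm, pow_succ, pow_mul, hD, one_pow, one_mul]
  · push Not at hex
    obtain ⟨D', hD'⟩ := MonomialData.exists_of_le (le_monomialSL hG even_two fun g hg hd i => by
      have h1 := (D.isDiag_iff ⟨g, hg⟩).mp hd
      have h2 : g i i = D.coeff ⟨g, hg⟩ i := by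
        have h3 := congrFun (congrFun (D.coe_eq ⟨g, hg⟩) i) i
        rw [h1] at h3
        simpa [monomialMatrix_apply] using h3
      rw [h2]
      exact hex _ h1 i)
    obtain ⟨g, hgG, hd, hne⟩ : ∃ g ∈ G, g ∈ diagonalSL 3 k ∧ g ≠ 1 := by
      rcases hG with ⟨A, hA, hbot, rfl⟩ | ⟨A, hA, hbot, α, β, γ, h, rfl⟩ <;>
      · obtain ⟨⟨g, hg⟩, hne⟩ := Subgroup.ne_bot_iff_exists_ne_one.mp hbot
        exact ⟨g, Subgroup.subset_closure (Or.inl hg), hA hg, fun h => hne (Subtype.ext h)⟩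
    exact D'.hasLoop_of_coeff_sq_eq_one ht hD' ((D'.isDiag_iff ⟨g, hgG⟩).mp hd)
      fun h => hne (congrArg Subtype.val h)
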